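/- For an integer $N\ge 2$ let $f:\mathbb{R}^N\to\mathbb{R}^N$, $f_i(\theta)=\sum_{j=1}^N\sin(\theta_j-\theta_i)$, and for $\omega\in\mathbb{R}^N$ and $\gamma>0$ consider the Kuramoto system $\frac{d}{dt}\theta=\omega+\gamma f(\theta)$. A \emph{fully synchronous solution} is a point $\theta$ with $\omega+\gamma f(\theta)=0$ at which the Jacobian of the right-hand side is negative semi-definite with a one-dimensional kernel. Let $\gamma^\star(\omega)\in[0,\infty]$ be the infimum of all $\gamma>0$ for which the system has a fully synchronous solution, and, with $\|\cdot\|$ the Euclidean norm, put $$\gamma_{\min}(N)=\inf_{\substack{\omega\in\mathbb{R}^N,\ \|\omega\|=1\\ \sum_i\omega_i=0}}\gamma^\star(\omega),\qquad \gamma_{\max}(N)=\sup_{\substack{\omega\in\mathbb{R}^N,\ \|\omega\|=1\\ \sum_i\omega_i=0}}\gamma^\star(\omega).$$ **Theorem.** For $N\ge 2$ even, $\gamma_{\min}(N)=2N^{-3/2}$. For $N\ge 3$ odd, $\gamma_{\min}(N)=2N^{-3/2}+O(N^{-5/2})$, that is, $\gamma_{\min}(N)$ is finite and there is a constant $C$,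 independent of $N$, such that $|\gamma_{\min}(N)-2N^{-3/2}|\le C N^{-5/2}$ for all odd $N\ge 3$. Moreover, for all $N\ge 2$, $$\frac{1}{\sqrt{N(N-1)}}\le\gamma_{\max}(N)\le\frac{\sqrt2}{\sqrt{N(N-1)}}.$$ -/

import Mathlib

open scoped ENNReal

noncomputable section

namespace Kuramoto

/-- The all-to-all sine coupling `f_i(θ) = ∑_j sin (θ_j - θ_i)`, with the angles lifted from the
torus to `ℝ^N` (Euclidean norm). -/
def coupling (N : ℕ) (θ : EuclideanSpace ℝ (Fin N)) : EuclideanSpace ℝ (Fin N) :=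
  WithLp.toLp 2 (fun i => ∑ j, Real.sin (θ j - θ i))

/-- The right-hand side `ω + γ f(θ)` of the Kuramoto system `θ' = ω + γ f(θ)`. -/
def vectorField {N : ℕ} (ω : EuclideanSpace ℝ (Fin N)) (γ : ℝ) (θ : EuclideanSpace ℝ (Fin N)) :
    EuclideanSpace ℝ (Fin N) :=
  ω + γ • coupling N θ

/-- `θ` is a fully synchronous solution: it is stationary, and the Jacobian of the vector field
at `θ` is negative semi-definite with a one-dimensional kernel. -/
def IsFullySynchronous {N : ℕ} (ω : EuclideanSpace ℝ (Fin N)) (γ : ℝ)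
    (θ : EuclideanSpace ℝ (Fin N)) : Prop :=
  vectorField ω γ θ = 0 ∧
    (-(fderiv ℝ (vectorField ω γ) θ)).IsPositive ∧
    Module.finrank ℝ (LinearMap.ker (fderiv ℝ (vectorField ω γ) θ).toLinearMap) = 1

/-- `γ⋆(ω)`: the infimum of the couplings `γ > 0` for which a fully synchronous solution exists
(it is `∞` when there is no such `γ`). -/
def criticalCoupling {N : ℕ} (ω : EuclideanSpace ℝ (Fin N)) : ℝ≥0∞ :=
  sInf {c : ℝ≥0∞ | ∃ γ : ℝ, 0 < γ ∧ (∃ θ, IsFullySynchronous ω γ θ) ∧ c = ENNReal.ofReal γ}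

/-- Frequency vectors of Euclidean norm one, in the co-rotating frame, that is, of mean zero. -/
def unitFrequencies (N : ℕ) : Set (EuclideanSpace ℝ (Fin N)) :=
  {ω | ∑ i, ω i = 0 ∧ ‖ω‖ = 1}

/-- The lower critical coupling `γ_min(N)`. -/
def gammaMin (N : ℕ) : ℝ≥0∞ := ⨅ ω ∈ unitFrequencies N, criticalCoupling ω

/-- The upper critical coupling `γ_max(N)`. -/
def gammaMax (N : ℕ) : ℝ≥0∞ := ⨆ ω ∈ unitFrequencies N, criticalCoupling ω

end Kuramoto

end

/-!
A stationary point satisfies `ω = -γ f(θ)`, so for `‖ω‖ = 1` its coupling is `γ = 1 / ‖f(θ)‖`.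
Both critical couplings are therefore governed by the image under `f` of the stable angles.

Stability is only ever produced from one sufficient condition
(`isFullySynchronous_of_cos_pos`): if `cos (θ_j - θ_i) > 0` for all `i, j`, then minus the Jacobian
is the Laplacian of the complete graph with positive weights `γ cos (θ_j - θ_i)`; hence it is
positive semi-definite, and its kernel consists of the constant vectors.

* `γ_min` from below: if `R = |∑_j exp (i θ_j)|`, then `f_i² + g_i² = R²`, where
  `g_i = ∑_j cos (θ_j - θ_i)` and `∑_i g_i = R²`. By Cauchy-Schwarz
  `‖f‖² ≤ N R² - R⁴ / N ≤ N³ / 4` (`sum_sq_coupling_le`).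
* `γ_min` from above: two clusters of sizes `p + q = N` at an angle `φ < π / 2` are stable and have
  `‖f‖² = p q N sin² φ`. Letting `φ → π / 2` gives `γ_min ≤ 1 / √(p q N)`
  (`gammaMin_le_of_add_eq`), to be used with `p` and `q` as equal as possible.
* `γ_max` from below: for `ω` proportional to `(N - 1, -1, …, -1)` the first equation alone
  requires `γ ≥ 1 / √(N (N - 1))`, because `|f_1| ≤ N - 1`.
* `γ_max` from above: the ansatz `sin θ_i = v ω_i` reduces stationarity to the scalar equation
  `γ v ∑_i √(1 - v² ω_i²) = 1`. At `v = 1 / √2` the left side is at least `γ (N - 1 / 2) / √2`,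
  because `√(1 - t) ≥ 1 - t` on `[0, 1]` and `‖ω‖ = 1`. If this exceeds `1`, there is a solution
  `v < 1 / √2`; it has `|θ_i| < π / 4`, so it is stable.
-/

noncomputable section

namespace Kuramoto

/-! ### The Jacobian and a criterion for stability -/

theorem coupling_apply {N : ℕ} (θ : EuclideanSpace ℝ (Fin N)) (i : Fin N) :
    coupling N θ i = ∑ j, Real.sin (θ j - θ i) := rfl

theorem vectorField_apply {N : ℕ} (ω : EuclideanSpace ℝ (Fin N)) (γ : ℝ)
    (θ : EuclideanSpace ℝ (Fin N)) (i : Fin N) :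
    vectorField ω γ θ i = ω i + γ * ∑ j, Real.sin (θ j - θ i) := rfl

/-- The Jacobian of the vector field at `θ`: minus the Laplacian of the complete graph with weights
`γ cos (θ_j - θ_i)`. -/
def jacobian {N : ℕ} (γ : ℝ) (θ : EuclideanSpace ℝ (Fin N)) :
    EuclideanSpace ℝ (Fin N) →L[ℝ] EuclideanSpace ℝ (Fin N) :=
  (PiLp.continuousLinearEquiv 2 ℝ (fun _ : Fin N => ℝ)).symm.toContinuousLinearMap ∘L
    ContinuousLinearMap.pi fun i => γ • ∑ j, Real.cos (θ j - θ i) •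
      (EuclideanSpace.proj j - EuclideanSpace.proj i : EuclideanSpace ℝ (Fin N) →L[ℝ] ℝ)

theorem jacobian_apply {N : ℕ} (γ : ℝ) (θ v : EuclideanSpace ℝ (Fin N)) (i : Fin N) :
    jacobian γ θ v i = γ * ∑ j, Real.cos (θ j - θ i) * (v j - v i) := by
  simp [jacobian]

theorem hasFDerivAt_vectorField {N : ℕ} (ω : EuclideanSpace ℝ (Fin N)) (γ : ℝ)
    (θ : EuclideanSpace ℝ (Fin N)) :
    HasFDerivAt (vectorField ω γ) (jacobian γ θ) θ := by
  refine HasStrictFDerivAt.hasFDerivAt (hasStrictFDerivAt_euclidean.2 fun i => ?_)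
  have hproj (j : Fin N) : HasStrictFDerivAt (fun x : EuclideanSpace ℝ (Fin N) => x j)
      (EuclideanSpace.proj j : EuclideanSpace ℝ (Fin N) →L[ℝ] ℝ) θ :=
    (EuclideanSpace.proj j : EuclideanSpace ℝ (Fin N) →L[ℝ] ℝ).hasStrictFDerivAt
  have h := ((HasStrictFDerivAt.fun_sum (u := Finset.univ)
    fun j _ => ((hproj j).sub (hproj i)).sin).const_mul γ).const_add (ω i)
  exact h

theorem inner_jacobian {N : ℕ} (γ : ℝ) (θ v w : EuclideanSpace ℝ (Fin N)) :
    inner ℝ (jacobian γ θ v) w =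
      -(γ / 2 * ∑ i, ∑ j, Real.cos (θ j - θ i) * ((v j - v i) * (w j - w i))) := by
  have h1 : inner ℝ (jacobian γ θ v) w =
      γ * ∑ i, ∑ j, Real.cos (θ j - θ i) * (v j - v i) * w i := by
    simp only [PiLp.inner_apply, jacobian_apply, Finset.mul_sum,
      RCLike.inner_apply, conj_trivial]
    exact Finset.sum_congr rfl fun i _ => Finset.sum_congr rfl fun j _ => by ring
  have h2 : ∑ i, ∑ j, Real.cos (θ j - θ i) * (v j - v i) * w i =
      -∑ i, ∑ j, Real.cos (θ j - θ i) * (v j - v i) * w j := by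
    rw [Finset.sum_comm, ← Finset.sum_neg_distrib]
    refine Finset.sum_congr rfl fun i _ => ?_
    rw [← Finset.sum_neg_distrib]
    refine Finset.sum_congr rfl fun j _ => ?_
    rw [← neg_sub (θ j), Real.cos_neg]
    ring
  have h3 : ∑ i, ∑ j, Real.cos (θ j - θ i) * ((v j - v i) * (w j - w i)) =
      ∑ i, ∑ j, Real.cos (θ j - θ i) * (v j - v i) * w j -
        ∑ i, ∑ j, Real.cos (θ j - θ i) * (v j - v i) * w i := by
    simp only [← Finset.sum_sub_distrib]
    exact Finset.sum_congr rfl fun i _ => Finset.sum_congr rfl fun j _ => by ring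
  rw [h1, h3]
  linear_combination (γ / 2) * h2

theorem isFullySynchronous_of_cos_pos {N : ℕ} (hN : 2 ≤ N) {ω θ : EuclideanSpace ℝ (Fin N)}
    {γ : ℝ} (hγ : 0 < γ) (hstat : vectorField ω γ θ = 0)
    (hcos : ∀ i j, 0 < Real.cos (θ j - θ i)) : IsFullySynchronous ω γ θ := by
  have hfd : fderiv ℝ (vectorField ω γ) θ = jacobian γ θ := (hasFDerivAt_vectorField ω γ θ).fderiv
  have hterm (v : EuclideanSpace ℝ (Fin N)) (i j : Fin N) :
      0 ≤ Real.cos (θ j - θ i) * ((v j - v i) * (v j - v i)) :=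
    mul_nonneg (hcos i j).le (mul_self_nonneg _)
  refine ⟨hstat, ?_, ?_⟩
  · rw [hfd, ContinuousLinearMap.isPositive_iff]
    refine ⟨fun v w => ?_, fun v => ?_⟩
    · simp only [ContinuousLinearMap.coe_coe, inner_neg_left, inner_neg_right,
        ContinuousLinearMap.toLinearMap_neg, LinearMap.neg_apply]
      rw [real_inner_comm (jacobian γ θ w), inner_jacobian, inner_jacobian]
      simp only [mul_comm (v _ - v _)]
    · rw [neg_apply, inner_neg_left, inner_jacobian, neg_neg]
      exact mul_nonneg (by positivity)
        (Finset.sum_nonneg fun i _ => Finset.sum_nonneg fun j _ => hterm v i j)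
  · rw [hfd]
    let o : Fin N := ⟨0, by omega⟩
    have hone : (WithLp.toLp 2 fun _ => 1 : EuclideanSpace ℝ (Fin N)) ∈
        LinearMap.ker (jacobian γ θ).toLinearMap := by
      rw [LinearMap.mem_ker]
      ext i
      simp [jacobian_apply]
    refine finrank_eq_one_iff'.2 ⟨⟨_, hone⟩, fun h => ?_, fun ⟨v, hv⟩ => ⟨v o, ?_⟩⟩
    · have := congrArg (fun x : EuclideanSpace ℝ (Fin N) => x o) (congrArg Subtype.val h)
      simp at this
    · have hzero := inner_jacobian γ θ v v
      rw [show jacobian γ θ v = 0 from hv, inner_zero_left, eq_comm, neg_eq_zero,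
        mul_eq_zero_iff_left (by positivity),
        Finset.sum_eq_zero_iff_of_nonneg
          (fun i _ => Finset.sum_nonneg fun j _ => hterm v i j)] at hzero
      have ho := (Finset.sum_eq_zero_iff_of_nonneg fun j _ => hterm v o j).1
        (hzero o (Finset.mem_univ _))
      ext j
      have hj := ho j (Finset.mem_univ _)
      rw [mul_eq_zero_iff_left (hcos o j).ne', mul_self_eq_zero, sub_eq_zero] at hj
      simp [hj]

theorem criticalCoupling_le {N : ℕ} {ω θ : EuclideanSpace ℝ (Fin N)} {γ : ℝ} (hγ : 0 < γ)
    (h : IsFullySynchronous ω γ θ) : criticalCoupling ω ≤ ENNReal.ofReal γ :=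
  sInf_le ⟨γ, hγ, ⟨θ, h⟩, rfl⟩

theorem le_criticalCoupling {N : ℕ} {ω : EuclideanSpace ℝ (Fin N)} {c : ℝ}
    (h : ∀ γ θ, 0 < γ → vectorField ω γ θ = 0 → c ≤ γ) :
    ENNReal.ofReal c ≤ criticalCoupling ω := by
  refine le_sInf ?_
  rintro _ ⟨γ, hγ, ⟨θ, hθ⟩, rfl⟩
  exact ENNReal.ofReal_le_ofReal (h γ θ hγ hθ.1)

/-! ### Bounds for the lower critical coupling -/

theorem sum_sq_coupling_le {N : ℕ} (hN : 0 < N) (θ : EuclideanSpace ℝ (Fin N)) :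
    ∑ i, coupling N θ i ^ 2 ≤ (N : ℝ) ^ 3 / 4 := by
  have hN' : (0 : ℝ) < N := by exact_mod_cast hN
  set S := ∑ j, Real.sin (θ j) with hS
  set C := ∑ j, Real.cos (θ j) with hC
  have hf (i : Fin N) : coupling N θ i = S * Real.cos (θ i) - C * Real.sin (θ i) := by
    simp only [coupling_apply, Real.sin_sub, Finset.sum_sub_distrib, hS, hC, Finset.sum_mul]
  let g (i : Fin N) : ℝ := C * Real.cos (θ i) + S * Real.sin (θ i)
  have hg : ∑ i, g i = C ^ 2 + S ^ 2 := by
    simp only [g, Finset.sum_add_distrib, ← Finset.mul_sum, ← hC, ← hS]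
    ring
  have hfg : ∑ i, coupling N θ i ^ 2 + ∑ i, g i ^ 2 = N * (C ^ 2 + S ^ 2) := by
    rw [← Finset.sum_add_distrib]
    have (i : Fin N) : coupling N θ i ^ 2 + g i ^ 2 = C ^ 2 + S ^ 2 := by
      rw [hf]
      linear_combination (C ^ 2 + S ^ 2) * Real.sin_sq_add_cos_sq (θ i)
    rw [Finset.sum_congr rfl fun i _ => this i, Finset.sum_const, Finset.card_univ,
      Fintype.card_fin, nsmul_eq_mul]
  have hcs := sq_sum_le_card_mul_sum_sq (s := Finset.univ) (f := g)
  rw [hg, Finset.card_univ, Fintype.card_fin] at hcs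
  refine le_of_mul_le_mul_left ?_ hN'
  nlinarith [sq_nonneg ((N : ℝ) ^ 2 - 2 * (C ^ 2 + S ^ 2))]

theorem two_mul_rpow_neg_three_halves {x : ℝ} (hx : 0 < x) :
    2 * x ^ (-(3 / 2) : ℝ) = 2 / √(x ^ 3) := by
  rw [Real.rpow_neg hx.le, Real.sqrt_eq_rpow, ← Real.rpow_natCast, ← Real.rpow_mul hx.le,
    div_eq_mul_inv 2]
  norm_num [div_eq_mul_inv]

theorem le_gammaMin {N : ℕ} (hN : 2 ≤ N) :
    ENNReal.ofReal (2 * (N : ℝ) ^ (-(3 / 2) : ℝ)) ≤ gammaMin N := by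
  have hN' : (0 : ℝ) < N := by exact_mod_cast (by omega : 0 < N)
  refine le_iInf₂ fun ω hω => le_criticalCoupling fun γ θ hγ hθ => ?_
  have hω2 := EuclideanSpace.real_norm_sq_eq ω
  have hi (i : Fin N) : ω i ^ 2 = γ ^ 2 * coupling N θ i ^ 2 := by
    have : ω i + γ * coupling N θ i = 0 := congrArg (fun x : EuclideanSpace ℝ (Fin N) => x i) hθ
    rw [eq_neg_of_add_eq_zero_left this]
    ring
  rw [hω.2, Finset.sum_congr rfl fun i _ => hi i, ← Finset.mul_sum] at hω2
  have hb := mul_le_mul_of_nonneg_left (sum_sq_coupling_le (by omega) θ) (sq_nonneg γ)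
  rw [two_mul_rpow_neg_three_halves hN', div_le_iff₀ (by positivity)]
  refine le_of_sq_le_sq ?_ (by positivity)
  rw [mul_pow, Real.sq_sqrt (by positivity)]
  linarith

theorem sum_ite_val_lt {N p q : ℕ} (h : p + q = N) (a b : ℝ) :
    ∑ i : Fin N, (if i.val < p then a else b) = p * a + q * b := by
  subst h
  simp [Fin.sum_univ_add]

theorem gammaMin_le_of_add_eq {N p q : ℕ} (h : p + q = N) (hp : 0 < p) (hq : 0 < q) :
    gammaMin N ≤ ENNReal.ofReal (1 / √((p : ℝ) * q * N)) := by
  have hp' : (0 : ℝ) < p := by exact_mod_cast hp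
  have hq' : (0 : ℝ) < q := by exact_mod_cast hq
  have hNr : (p : ℝ) + q = N := by exact_mod_cast h
  have hN' : (0 : ℝ) < N := by linarith
  set r := √((p : ℝ) * q * N) with hr
  have hr0 : 0 < r := by positivity
  have hr2 : r ^ 2 = p * q * N := Real.sq_sqrt (by positivity)
  let ω : EuclideanSpace ℝ (Fin N) :=
    WithLp.toLp 2 fun i => if i.val < p then -(q / r) else p / r
  have hω : ω ∈ unitFrequencies N := by
    refine ⟨(sum_ite_val_lt h _ _).trans (by ring), ?_⟩
    rw [← sq_eq_sq₀ (norm_nonneg _) zero_le_one, EuclideanSpace.real_norm_sq_eq]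
    have : ∑ i, ω i ^ 2 = ∑ i : Fin N, if i.val < p then (-((q : ℝ) / r)) ^ 2 else (p / r) ^ 2 :=
      Finset.sum_congr rfl fun i _ => by simp only [ω]; split_ifs <;> rfl
    rw [this, sum_ite_val_lt h]
    field_simp
    rw [hr2, ← hNr]
    ring
  refine (iInf₂_le ω hω).trans ?_
  -- The value `1 / r` belongs to `φ = π / 2`, where stability is lost, so it is approached from
  -- above.
  refine le_of_forall_gt_imp_ge_of_dense fun c hc => ?_
  induction c with
  | top => exact le_top
  | coe c =>
  rw [← ENNReal.ofReal_coe_nnreal] at hc ⊢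
  have hc' : 1 / r < c := (ENNReal.ofReal_lt_ofReal_iff_of_nonneg (by positivity)).1 hc
  have hc0 : (0 : ℝ) < c := lt_trans (by positivity) hc'
  have hcr : 1 < c * r := (div_lt_iff₀ hr0).1 hc'
  set s : ℝ := 1 / (c * r) with hs
  have hs0 : 0 < s := by positivity
  have hs1 : s < 1 := (div_lt_one (by positivity)).2 hcr
  set φ := Real.arcsin s with hφ
  have hsin : Real.sin φ = s := Real.sin_arcsin (by linarith) hs1.le
  have hcos : 0 < Real.cos φ := Real.cos_pos_of_mem_Ioo
    ⟨by linarith [Real.arcsin_nonneg.2 hs0.le, Real.pi_pos], Real.arcsin_lt_pi_div_two.2 hs1⟩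
  let θ : EuclideanSpace ℝ (Fin N) := WithLp.toLp 2 fun i => if i.val < p then 0 else φ
  refine criticalCoupling_le hc0 (isFullySynchronous_of_cos_pos (by omega) (θ := θ) hc0 ?_ ?_)
  · ext i
    rw [vectorField_apply]
    by_cases hi : i.val < p
    · have (j : Fin N) : Real.sin (θ j - θ i) = if j.val < p then 0 else s := by
        simp only [θ, hi, if_true, sub_zero]
        split_ifs <;> simp [hsin]
      simp only [this, sum_ite_val_lt h, ω, hi, if_true, hs, PiLp.zero_apply]
      field_simp
      ring
    · have (j : Fin N) : Real.sin (θ j - θ i) = if j.val < p then -s else 0 := by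
        simp only [θ, hi, if_false]
        split_ifs <;> simp [hsin]
      simp only [this, sum_ite_val_lt h, ω, hi, if_false, hs, PiLp.zero_apply]
      field_simp
      ring
  · intro i j
    simp only [θ]
    split_ifs <;> simp [hcos]

theorem gammaMin_of_even {N : ℕ} (hN : 2 ≤ N) (he : Even N) :
    gammaMin N = ENNReal.ofReal (2 * (N : ℝ) ^ (-(3 / 2) : ℝ)) := by
  refine le_antisymm ?_ (le_gammaMin hN)
  obtain ⟨k, rfl⟩ := he
  refine (gammaMin_le_of_add_eq rfl (by omega) (by omega)).trans (ENNReal.ofReal_le_ofReal ?_)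
  have hk : (0 : ℝ) < k := by exact_mod_cast (by omega : 0 < k)
  rw [two_mul_rpow_neg_three_halves (by push_cast; linarith)]
  have : √(((k + k : ℕ) : ℝ) ^ 3) = 2 * √((k : ℝ) * k * (k + k : ℕ)) := by
    rw [show ((k + k : ℕ) : ℝ) ^ 3 = 2 ^ 2 * (k * k * (k + k : ℕ)) by push_cast; ring,
      Real.sqrt_mul (by norm_num), Real.sqrt_sq (by norm_num)]
  rw [this]
  apply le_of_eq
  have : 0 < √((k : ℝ) * k * (k + k : ℕ)) := by push_cast; positivity
  field_simp

theorem gammaMin_of_odd {N : ℕ} (hN : 2 ≤ N) (ho : Odd N) :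
    gammaMin N ≠ ⊤ ∧ |(gammaMin N).toReal - 2 * (N : ℝ) ^ (-(3 / 2) : ℝ)|
      ≤ 2 * (N : ℝ) ^ (-(5 / 2) : ℝ) := by
  obtain ⟨k, hk⟩ := ho
  have hk0 : (0 : ℝ) < k := by exact_mod_cast (by omega : 0 < k)
  have hNk : (N : ℝ) = 2 * k + 1 := by exact_mod_cast hk
  have hN0 : (0 : ℝ) < N := by linarith
  have hup := gammaMin_le_of_add_eq (N := N) (p := k) (q := k + 1) (by omega) (by omega) (by omega)
  have htop : gammaMin N ≠ ⊤ := ne_top_of_le_ne_top ENNReal.ofReal_ne_top hup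
  refine ⟨htop, ?_⟩
  have hlow := (ENNReal.ofReal_le_iff_le_toReal htop).1 (le_gammaMin hN)
  have hup' := ENNReal.toReal_le_of_le_ofReal (by positivity) hup
  rw [abs_of_nonneg (sub_nonneg.2 hlow), sub_le_iff_le_add]
  refine hup'.trans ?_
  have h5 : (N : ℝ) ^ (-(5 / 2) : ℝ) = (N : ℝ) ^ (-(3 / 2) : ℝ) / N := by
    rw [← Real.rpow_sub_one hN0.ne']
    norm_num
  -- The claim becomes `N⁴ ≤ (N² - 1) (N + 1)²`.
  rw [h5, show 2 * ((N : ℝ) ^ (-(3 / 2) : ℝ) / N) + 2 * (N : ℝ) ^ (-(3 / 2) : ℝ) =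
    (1 + 1 / N) * (2 * (N : ℝ) ^ (-(3 / 2) : ℝ)) by ring, two_mul_rpow_neg_three_halves hN0,
    mul_div_assoc', div_le_div_iff₀ (by positivity) (by positivity), one_mul]
  refine Real.sqrt_le_iff.2 ⟨by positivity, ?_⟩
  rw [mul_pow, Real.sq_sqrt (by positivity), show (1 + 1 / (N : ℝ)) = (N + 1) / N by field_simp]
  push_cast
  rw [div_mul_eq_mul_div, div_pow, div_mul_eq_mul_div, le_div_iff₀ (by positivity), hNk]
  have hk1 : (1 : ℝ) ≤ k := by exact_mod_cast (by omega : 1 ≤ k)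
  have hpoly : (2 * (k : ℝ) + 1) ^ 4 ≤ 16 * (k + 1) ^ 3 * k := by
    nlinarith [pow_pos hk0 2, pow_pos hk0 3]
  linarith [mul_le_mul_of_nonneg_left hpoly (show (0 : ℝ) ≤ 2 * k + 1 by positivity)]

/-! ### Bounds for the upper critical coupling -/

theorem abs_coupling_le {N : ℕ} (θ : EuclideanSpace ℝ (Fin N)) (i : Fin N) :
    |coupling N θ i| ≤ N - 1 := by
  rw [coupling_apply, ← Finset.sum_erase Finset.univ (a := i) (by simp)]
  refine (Finset.abs_sum_le_sum_abs _ _).trans ?_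
  refine (Finset.sum_le_card_nsmul _ _ 1 fun j _ => Real.abs_sin_le_one _).trans ?_
  have : 1 ≤ N := by have := i.isLt; omega
  simp [Finset.card_erase_of_mem, this]

theorem le_gammaMax {N : ℕ} (hN : 2 ≤ N) :
    ENNReal.ofReal (1 / √((N : ℝ) * ((N : ℝ) - 1))) ≤ gammaMax N := by
  have hN2 : (2 : ℝ) ≤ N := by exact_mod_cast hN
  have hN1 : (0 : ℝ) < N - 1 := by linarith
  have hN0 : (0 : ℝ) < N := by linarith
  set r := √((N : ℝ) * ((N : ℝ) - 1)) with hr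
  have hr0 : 0 < r := by positivity
  have hr2 : r ^ 2 = N * (N - 1) := Real.sq_sqrt (by positivity)
  have hcast : ((N - 1 : ℕ) : ℝ) = N - 1 := by rw [Nat.cast_sub (by omega), Nat.cast_one]
  let ω : EuclideanSpace ℝ (Fin N) :=
    WithLp.toLp 2 fun i => if i.val < 1 then (N - 1) / r else -(1 / r)
  have hω : ω ∈ unitFrequencies N := by
    refine ⟨(sum_ite_val_lt (p := 1) (q := N - 1) (by omega) _ _).trans ?_, ?_⟩
    · rw [hcast]
      push_cast
      ring
    rw [← sq_eq_sq₀ (norm_nonneg _) zero_le_one, EuclideanSpace.real_norm_sq_eq]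
    have : ∑ i, ω i ^ 2 = ∑ i : Fin N, if i.val < 1 then (((N : ℝ) - 1) / r) ^ 2
        else (-(1 / r)) ^ 2 :=
      Finset.sum_congr rfl fun i _ => by simp only [ω]; split_ifs <;> rfl
    rw [this, sum_ite_val_lt (p := 1) (q := N - 1) (by omega), hcast]
    field_simp
    rw [hr2]
    push_cast
    ring
  refine le_trans (le_criticalCoupling fun γ θ hγ hθ => ?_)
    (le_iSup₂ (f := fun ω (_ : ω ∈ unitFrequencies N) => criticalCoupling ω) ω hω)
  let o : Fin N := ⟨0, by omega⟩
  have ho : (N - 1) / r + γ * coupling N θ o = 0 :=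
    congrArg (fun x : EuclideanSpace ℝ (Fin N) => x o) hθ
  have hb := mul_le_mul_of_nonneg_left (neg_le_of_abs_le (abs_coupling_le θ o)) hγ.le
  refine le_of_mul_le_mul_left ?_ hN1
  rw [mul_one_div]
  linarith

/-- A unit frequency vector has a fully synchronous solution, with all angles in
`(-π / 4, π / 4)`, as soon as `γ (N - 1 / 2) > √2`. -/
theorem exists_isFullySynchronous {N : ℕ} (hN : 2 ≤ N) {ω : EuclideanSpace ℝ (Fin N)}
    (hω : ω ∈ unitFrequencies N) {γ : ℝ} (hγ : 0 < γ) (hlt : √2 < γ * (N - 1 / 2)) :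
    ∃ θ, IsFullySynchronous ω γ θ := by
  have hsum : ∑ i, ω i ^ 2 = 1 := by rw [← EuclideanSpace.real_norm_sq_eq, hω.2, one_pow]
  have hle (i : Fin N) : ω i ^ 2 ≤ 1 :=
    hsum ▸ Finset.single_le_sum (f := fun i => ω i ^ 2) (fun j _ => sq_nonneg _) (Finset.mem_univ i)
  let G (v : ℝ) : ℝ := γ * v * ∑ i, √(1 - (v * ω i) ^ 2)
  have hG : Continuous G := by fun_prop
  have hpos : (0 : ℝ) < 1 / √2 := by positivity
  have hsq : (1 / √2 : ℝ) ^ 2 = 1 / 2 := by rw [div_pow, Real.sq_sqrt zero_le_two, one_pow]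
  have hend : 1 < G (1 / √2) := by
    have hroot (i : Fin N) : 1 - ω i ^ 2 / 2 ≤ √(1 - (1 / √2 * ω i) ^ 2) := by
      rw [mul_pow, hsq]
      refine Real.le_sqrt_of_sq_le ?_
      nlinarith [hle i, sq_nonneg (ω i)]
    have h := Finset.sum_le_sum fun i (_ : i ∈ Finset.univ) => hroot i
    rw [Finset.sum_sub_distrib, ← Finset.sum_div, hsum] at h
    simp only [Finset.sum_const, Finset.card_univ, Fintype.card_fin, nsmul_eq_mul, mul_one] at h
    calc (1 : ℝ) < γ * (N - 1 / 2) / √2 := (one_lt_div (by positivity)).2 hlt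
      _ = γ * (1 / √2) * (N - 1 / 2) := by ring
      _ ≤ G (1 / √2) := mul_le_mul_of_nonneg_left h (by positivity)
  obtain ⟨v, ⟨hv0, hv1⟩, hv⟩ := intermediate_value_Icc hpos.le hG.continuousOn
    (show (1 : ℝ) ∈ Set.Icc (G 0) (G (1 / √2)) from ⟨by simp [G], hend.le⟩)
  have hv1' : v < 1 / √2 := lt_of_le_of_ne hv1 (by rintro rfl; exact hend.ne' hv)
  have hvω (i : Fin N) : (v * ω i) ^ 2 < 1 / 2 := by
    rw [mul_pow]
    nlinarith [hle i, sq_nonneg v, pow_lt_pow_left₀ hv1' hv0 two_ne_zero]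
  let θ : EuclideanSpace ℝ (Fin N) := WithLp.toLp 2 fun i => Real.arcsin (v * ω i)
  have habs (i : Fin N) : |v * ω i| ≤ 1 :=
    (sq_le_one_iff_abs_le_one _).1 ((hvω i).le.trans (by norm_num))
  have hsin (i : Fin N) : Real.sin (θ i) = v * ω i :=
    Real.sin_arcsin (neg_le_of_abs_le (habs i)) (le_of_abs_le (habs i))
  have hcos (i : Fin N) : Real.cos (θ i) = √(1 - (v * ω i) ^ 2) := Real.cos_arcsin _
  have hcos_sq (i : Fin N) : 1 / 2 < Real.cos (θ i) ^ 2 := by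
    rw [Real.cos_sq', hsin]
    linarith [hvω i]
  refine ⟨θ, isFullySynchronous_of_cos_pos hN hγ ?_ fun i j => ?_⟩
  · ext i
    have hS : ∑ j, Real.sin (θ j) = 0 := by
      simp only [hsin, ← Finset.mul_sum, hω.1, mul_zero]
    have hC : γ * v * ∑ j, Real.cos (θ j) = 1 := by
      simp only [hcos]
      exact hv
    rw [vectorField_apply]
    simp only [Real.sin_sub, Finset.sum_sub_distrib, ← Finset.sum_mul, hS, PiLp.zero_apply,
      hsin i]
    linear_combination -(ω i) * hC
  · rw [Real.cos_sub]
    have hlt' : |Real.sin (θ j) * Real.sin (θ i)| < Real.cos (θ j) * Real.cos (θ i) := by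
      refine abs_lt_of_sq_lt_sq ?_
        (mul_nonneg (hcos j ▸ Real.sqrt_nonneg _) (hcos i ▸ Real.sqrt_nonneg _))
      rw [mul_pow, mul_pow, hsin, hsin]
      refine mul_lt_mul'' ?_ ?_ (sq_nonneg _) (sq_nonneg _)
      · exact (hvω j).trans (hcos_sq j)
      · exact (hvω i).trans (hcos_sq i)
    linarith [neg_lt_of_abs_lt hlt']

theorem gammaMax_le {N : ℕ} (hN : 2 ≤ N) :
    gammaMax N ≤ ENNReal.ofReal (√2 / √((N : ℝ) * ((N : ℝ) - 1))) := by
  have hN2 : (2 : ℝ) ≤ N := by exact_mod_cast hN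
  have hprod : (0 : ℝ) < N * (N - 1) := mul_pos (by linarith) (by linarith)
  have hγ : 0 < √2 / √((N : ℝ) * ((N : ℝ) - 1)) := by positivity
  refine iSup₂_le fun ω hω => ?_
  obtain ⟨θ, hθ⟩ := exists_isFullySynchronous hN hω hγ <| by
    rw [div_mul_eq_mul_div, lt_div_iff₀ (by positivity)]
    refine mul_lt_mul_of_pos_left ?_ (by positivity)
    rw [Real.sqrt_lt' (by linarith)]
    nlinarith
  exact criticalCoupling_le hγ hθ

end Kuramoto

end

theorem mainTheorem4 :
    (∀ N : ℕ, 2 ≤ N → Even N →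
      Kuramoto.gammaMin N = ENNReal.ofReal (2 * (N : ℝ) ^ (-(3 / 2) : ℝ))) ∧
    (∃ C : ℝ, ∀ N : ℕ, 2 ≤ N → Odd N →
      Kuramoto.gammaMin N ≠ ⊤ ∧
        |(Kuramoto.gammaMin N).toReal - 2 * (N : ℝ) ^ (-(3 / 2) : ℝ)|
          ≤ C * (N : ℝ) ^ (-(5 / 2) : ℝ)) ∧
    (∀ N : ℕ, 2 ≤ N →
      ENNReal.ofReal (1 / √((N : ℝ) * ((N : ℝ) - 1))) ≤ Kuramoto.gammaMax N ∧
        Kuramoto.gammaMax N ≤ ENNReal.ofReal (√2 / √((N : ℝ) * ((N : ℝ) - 1)))) :=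
  ⟨fun _ hN he => Kuramoto.gammaMin_of_even hN he,
    ⟨2, fun _ hN ho => Kuramoto.gammaMin_of_odd hN ho⟩,
    fun _ hN => ⟨Kuramoto.le_gammaMax hN, Kuramoto.gammaMax_le hN⟩⟩
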